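/- All Hilbert spaces are complex, with inner product $\langle\cdot,\cdot\rangle$ linear in the first entry, and $\otimes$ is the Hilbert space tensor product. Let $K$ be a Pick kernel on a set $\Lambda$: a positive definite kernel such that, for every base point $\lambda_0$ with $K(\lambda_0,\lambda_0)\neq 0$, the function $1-\frac{K(\mu,\lambda_0)K(\lambda_0,\lambda)}{K(\mu,\lambda)K(\lambda_0,\lambda_0)}$ is again a positive definite kernel (it is considered on the set of points $\lambda$ with $K(\lambda,\lambda)\ne0$, where $K$ is assumed to have no zeros; if $K$ never vanishes this is all of $\Lambda$). Let $\mathfrak H(K)$ be the reproducing kernel Hilbert space of $K$, let $k_\lambda=K(\cdot,\lambda)$, fix $\lambda_0$ with $K(\lambda_0,\lambda_0)\ne 0$, and put $\delta=k_{\lambda_0}/\|k_{\lambda_0}\|$. Let $\mathcal B$ be a Hilbert space and $\beta:\Lambda\to\mathcal B$ a function with $\|\beta(\lambda)\|<1$, with $\{\beta(\lambda)\}$ total in $\mathcal B$, and with $$K(\mu,\lambda)=\frac{\delta(\mu)\overline{\delta(\lambda)}}{1-\langle\beta(\lambda),\beta(\mu)\rangle}\qquad(\lambda,\mu\in\Lambda)$$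 (such $\mathcal B,\beta$ exist). For Hilbert spaces $\mathcal G',\mathcal G$, a function $G:\Lambda\to\mathcal L(\mathcal G',\mathcal G)$ is a multiplier if $k_\lambda\otimes\xi\mapsto k_\lambda\otimes G(\lambda)^*\xi$ extends to a bounded operator $\mathfrak m_G^*:\mathfrak H(K)\otimes\mathcal G\to\mathfrak H(K)\otimes\mathcal G'$, and a contractive multiplier if it extends to a contraction; $\mathfrak m_G$ is the adjoint of this operator, and $\mathcal M_G$ is the image of $\mathfrak m_G$, with the norm $\|x\|_{\mathcal M_G}=\inf\{\|y\|:\mathfrak m_Gy=x\}$ if $G$ is contractive. The function $B(\lambda):\mathcal B\to\mathbb C$, $B(\lambda)\xi=\langle\xi,\beta(\lambda)\rangle$, is a contractive multiplier; let $\boldsymbol B=\mathfrak m_B$, regarded as an operator $\mathcal B\otimes\mathfrak H(K)\to\mathfrak H(K)$. Let $\mathcal G$ be a Hilbert space and $\mathcal M\subset\mathfrak H(K)\otimes\mathcal G$ a closed subspace such that $(\boldsymbol B\otimes I_{\mathcal G})(\mathcal B\otimes\mathcal M)\subset\mathcal M$. Then there exist a Hilbert space $\mathcal G'$ and a contractive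 multiplier $G:\Lambda\to\mathcal L(\mathcal G',\mathcal G)$ such that $\mathfrak m_G\mathfrak m_G^*$ is the orthogonal projection of $\mathfrak H(K)\otimes\mathcal G$ onto $\mathcal M$. In particular $\mathcal M=\mathcal M_G$, with equality of norms. -/

import Mathlib

universe u v

open scoped TensorProduct ComplexOrder

noncomputable section

/-! ### Hilbert space tensor products -/

/-- The Hilbert space tensor product of two complex inner product spaces: the completion of the
algebraic tensor product for `⟪x ⊗ y, x' ⊗ y'⟫ = ⟪x, x'⟫ ⟪y, y'⟫`. -/
abbrev HTensor (E F : Type*) [NormedAddCommGroup E] [InnerProductSpace ℂ E]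
    [NormedAddCommGroup F] [InnerProductSpace ℂ F] : Type _ :=
  UniformSpace.Completion (E ⊗[ℂ] F)

namespace HTensor

variable {E F E' F' G : Type*}
  [NormedAddCommGroup E] [InnerProductSpace ℂ E] [NormedAddCommGroup F] [InnerProductSpace ℂ F]
  [NormedAddCommGroup E'] [InnerProductSpace ℂ E'] [NormedAddCommGroup F'] [InnerProductSpace ℂ F']
  [NormedAddCommGroup G] [InnerProductSpace ℂ G]

/-- The simple tensor `x ⊗ y` in the Hilbert space tensor product. -/
def tmul (x : E) (y : F) : HTensor E F := ((x ⊗ₜ[ℂ] y : E ⊗[ℂ] F) : HTensor E F)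

theorem tmul_add_left (x x' : E) (y : F) : tmul (x + x') y = tmul x y + tmul x' y := by
  rw [tmul, TensorProduct.add_tmul]; exact UniformSpace.Completion.coe_add _ _

theorem tmul_smul_left (c : ℂ) (x : E) (y : F) : tmul (c • x) y = c • tmul x y := by
  rw [tmul, ← TensorProduct.smul_tmul']; exact UniformSpace.Completion.coe_smul _ _

theorem inner_tmul (x x' : E) (y y' : F) :
    inner ℂ (tmul x y) (tmul x' y') = inner ℂ x x' * inner ℂ y y' := by
  simp [tmul]

theorem denseRange_toComplL : DenseRange (UniformSpace.Completion.toComplL (𝕜 := ℂ) (E := E)) :=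
  UniformSpace.Completion.denseRange_coe

theorem isUniformInducing_toComplL :
    IsUniformInducing (UniformSpace.Completion.toComplL (𝕜 := ℂ) (E := E)) :=
  UniformSpace.Completion.isUniformInducing_coe E

/-- The tensor product `f ⊗ g` of two bounded operators. -/
def map (f : E →L[ℂ] E') (g : F →L[ℂ] F') : HTensor E F →L[ℂ] HTensor E' F' :=
  (UniformSpace.Completion.toComplL ∘L TensorProduct.mapL f g).extend
    UniformSpace.Completion.toComplL

theorem map_tmul (f : E →L[ℂ] E') (g : F →L[ℂ] F') (x : E) (y : F) :
    map f g (tmul x y) = tmul (f x) (g y) :=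
  ContinuousLinearMap.extend_eq _ denseRange_toComplL isUniformInducing_toComplL (x ⊗ₜ[ℂ] y)

/-- The simple tensors are total. -/
theorem topologicalClosure_span_tmul :
    (Submodule.span ℂ {z : HTensor E F | ∃ x y, tmul x y = z}).topologicalClosure = ⊤ := by
  rw [← Submodule.dense_iff_topologicalClosure_eq_top]
  refine (denseRange_toComplL (E := E ⊗[ℂ] F)).mono ?_
  rintro _ ⟨z, rfl⟩
  induction z using TensorProduct.induction_on with
  | zero => rw [map_zero]; exact Submodule.zero_mem _
  | tmul x y => exact Submodule.subset_span ⟨x, y, rfl⟩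
  | add a b ha hb => rw [map_add]; exact Submodule.add_mem _ ha hb

/-- Two bounded operators that agree on simple tensors are equal. -/
theorem ext_tmul {S T : HTensor E F →L[ℂ] G} (h : ∀ x y, S (tmul x y) = T (tmul x y)) :
    S = T := by
  refine ContinuousLinearMap.ext_on
    (Submodule.dense_iff_topologicalClosure_eq_top.2 topologicalClosure_span_tmul) ?_
  rintro _ ⟨x, y, rfl⟩
  exact h x y

theorem continuous_tmul_left (y : F) : Continuous fun x : E => tmul x y := by
  refine (UniformSpace.Completion.continuous_coe _).comp ?_
  refine AddMonoidHomClass.continuous_of_bound ((TensorProduct.mk ℂ E F).flip y) ‖y‖ fun x => ?_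
  simp [mul_comm]

theorem continuous_tmul_right (x : E) : Continuous fun y : F => tmul x y := by
  refine (UniformSpace.Completion.continuous_coe _).comp ?_
  refine AddMonoidHomClass.continuous_of_bound (TensorProduct.mk ℂ E F x) ‖x‖ fun y => ?_
  simp

/-- The swap `E ⊗ F ≅ F ⊗ E`. -/
def comm (E F : Type*) [NormedAddCommGroup E] [InnerProductSpace ℂ E]
    [NormedAddCommGroup F] [InnerProductSpace ℂ F] : HTensor E F ≃ₗᵢ[ℂ] HTensor F E :=
  (TensorProduct.comm ℂ E F).extendOfIsometry
    (UniformSpace.Completion.toComplL (𝕜 := ℂ) (E := E ⊗[ℂ] F)).toLinearMap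
    (UniformSpace.Completion.toComplL (𝕜 := ℂ) (E := F ⊗[ℂ] E)).toLinearMap
    denseRange_toComplL denseRange_toComplL (fun x => by simp)

theorem comm_tmul (x : E) (y : F) : comm E F (tmul x y) = tmul y x :=
  LinearEquiv.extendOfIsometry_eq (TensorProduct.comm ℂ E F) _ _ _ _ _ (x ⊗ₜ[ℂ] y)

/-- The identification `E ⊗ ℂ ≅ E` for a Hilbert space `E`. -/
def rid (E : Type*) [NormedAddCommGroup E] [InnerProductSpace ℂ E] [CompleteSpace E] :
    HTensor E ℂ ≃ₗᵢ[ℂ] E :=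
  (TensorProduct.rid ℂ E).extendOfIsometry
    (UniformSpace.Completion.toComplL (𝕜 := ℂ) (E := E ⊗[ℂ] ℂ)).toLinearMap
    LinearMap.id denseRange_toComplL denseRange_id (fun x => by simp)

theorem rid_tmul [CompleteSpace E] (x : E) (c : ℂ) : rid E (tmul x c) = c • x :=
  LinearEquiv.extendOfIsometry_eq (TensorProduct.rid ℂ E) _ _ _ _ _ (x ⊗ₜ[ℂ] c)

/-- The dense isometric inclusion of the algebraic `(E ⊗ F) ⊗ G` in `(E ⊗ F) ⊗ G`. -/
def inclLeft (E F G : Type*) [NormedAddCommGroup E] [InnerProductSpace ℂ E]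
    [NormedAddCommGroup F] [InnerProductSpace ℂ F] [NormedAddCommGroup G] [InnerProductSpace ℂ G] :
    (E ⊗[ℂ] F) ⊗[ℂ] G →ₗᵢ[ℂ] HTensor (HTensor E F) G :=
  UniformSpace.Completion.toComplₗᵢ.comp
    (TensorProduct.mapIsometry UniformSpace.Completion.toComplₗᵢ LinearIsometry.id)

/-- The dense isometric inclusion of the algebraic `E ⊗ (F ⊗ G)` in `E ⊗ (F ⊗ G)`. -/
def inclRight (E F G : Type*) [NormedAddCommGroup E] [InnerProductSpace ℂ E]
    [NormedAddCommGroup F] [InnerProductSpace ℂ F] [NormedAddCommGroup G] [InnerProductSpace ℂ G] :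
    E ⊗[ℂ] (F ⊗[ℂ] G) →ₗᵢ[ℂ] HTensor E (HTensor F G) :=
  UniformSpace.Completion.toComplₗᵢ.comp
    (TensorProduct.mapIsometry LinearIsometry.id UniformSpace.Completion.toComplₗᵢ)

theorem denseRange_inclLeft : DenseRange (inclLeft E F G) := by
  have key : ∀ (w : HTensor E F) (z : G),
      tmul w z ∈ closure (Set.range (inclLeft E F G)) := by
    intro w z
    induction w using UniformSpace.Completion.induction_on with
    | hp => exact isClosed_closure.preimage (continuous_tmul_left z)
    | ih a => exact subset_closure ⟨a ⊗ₜ[ℂ] z, by simp [inclLeft, tmul]⟩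
  have h : (LinearMap.range (inclLeft E F G).toLinearMap).topologicalClosure = ⊤ := by
    rw [eq_top_iff, ← topologicalClosure_span_tmul]
    refine Submodule.topologicalClosure_minimal _ (Submodule.span_le.2 ?_)
      (Submodule.isClosed_topologicalClosure _)
    rintro _ ⟨w, z, rfl⟩
    exact key w z
  exact Submodule.dense_iff_topologicalClosure_eq_top.2 h

theorem denseRange_inclRight : DenseRange (inclRight E F G) := by
  have key : ∀ (x : E) (w : HTensor F G),
      tmul x w ∈ closure (Set.range (inclRight E F G)) := by
    intro x w
    induction w using UniformSpace.Completion.induction_on with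
    | hp => exact isClosed_closure.preimage (continuous_tmul_right x)
    | ih a => exact subset_closure ⟨x ⊗ₜ[ℂ] a, by simp [inclRight, tmul]⟩
  have h : (LinearMap.range (inclRight E F G).toLinearMap).topologicalClosure = ⊤ := by
    rw [eq_top_iff, ← topologicalClosure_span_tmul]
    refine Submodule.topologicalClosure_minimal _ (Submodule.span_le.2 ?_)
      (Submodule.isClosed_topologicalClosure _)
    rintro _ ⟨w, z, rfl⟩
    exact key w z
  exact Submodule.dense_iff_topologicalClosure_eq_top.2 h

/-- Associativity `(E ⊗ F) ⊗ G ≅ E ⊗ (F ⊗ G)`. -/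
def assoc (E F G : Type*) [NormedAddCommGroup E] [InnerProductSpace ℂ E]
    [NormedAddCommGroup F] [InnerProductSpace ℂ F] [NormedAddCommGroup G] [InnerProductSpace ℂ G] :
    HTensor (HTensor E F) G ≃ₗᵢ[ℂ] HTensor E (HTensor F G) :=
  (TensorProduct.assoc ℂ E F G).extendOfIsometry
    (inclLeft E F G).toLinearMap (inclRight E F G).toLinearMap
    denseRange_inclLeft denseRange_inclRight (fun x => by
      simp only [LinearIsometry.coe_toLinearMap, LinearIsometry.norm_map]
      exact (TensorProduct.assocIsometry ℂ E F G).norm_map x)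

theorem assoc_tmul (x : E) (y : F) (z : G) :
    assoc E F G (tmul (tmul x y) z) = tmul x (tmul y z) := by
  have h := LinearEquiv.extendOfIsometry_eq (TensorProduct.assoc ℂ E F G)
    (inclLeft E F G).toLinearMap (inclRight E F G).toLinearMap
    denseRange_inclLeft denseRange_inclRight (fun x => by
      simp only [LinearIsometry.coe_toLinearMap, LinearIsometry.norm_map]
      exact (TensorProduct.assocIsometry ℂ E F G).norm_map x) ((x ⊗ₜ[ℂ] y) ⊗ₜ[ℂ] z)
  have hl : inclLeft E F G ((x ⊗ₜ[ℂ] y) ⊗ₜ[ℂ] z) = tmul (tmul x y) z := by simp [inclLeft, tmul]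
  have hr : inclRight E F G (x ⊗ₜ[ℂ] (y ⊗ₜ[ℂ] z)) = tmul x (tmul y z) := by simp [inclRight, tmul]
  rw [← hl, ← hr]
  exact h

/-- The closed subspace `E ⊗ M` of `E ⊗ F`, for a subspace `M` of `F`: the image of the Hilbert
space tensor product of `E` and `M` under `I ⊗ ι`, with `ι : M → F` the inclusion. -/
def tensorSubspace (E : Type*) [NormedAddCommGroup E] [InnerProductSpace ℂ E]
    (M : Submodule ℂ F) : Submodule ℂ (HTensor E F) :=
  LinearMap.range (map (ContinuousLinearMap.id ℂ E) M.subtypeL).toLinearMap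

end HTensor

/-! ### Multipliers of a reproducing kernel Hilbert space -/

section Multipliers

variable {Λ : Type*} (H : Type*) [NormedAddCommGroup H] [InnerProductSpace ℂ H] [CompleteSpace H]
  [RKHS ℂ H Λ ℂ]
  {𝒢' 𝒢 : Type*} [NormedAddCommGroup 𝒢'] [InnerProductSpace ℂ 𝒢'] [CompleteSpace 𝒢']
  [NormedAddCommGroup 𝒢] [InnerProductSpace ℂ 𝒢] [CompleteSpace 𝒢]

/-- The kernel function `k_l ∈ H`, for which `f l = ⟪k_l, f⟫`. -/
def kernelVec (l : Λ) : H := RKHS.kerFun H l (1 : ℂ)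

/-- `K` is the reproducing kernel of `H`, i.e. `k_l m = K m l`. -/
def HasKernel (K : Λ → Λ → ℂ) : Prop := ∀ m l, kernelVec H l m = K m l

/-- `S` is a bounded extension of the map `k_l ⊗ ξ ↦ k_l ⊗ (G l)* ξ`. -/
def IsMultiplierAdjoint (G : Λ → 𝒢' →L[ℂ] 𝒢) (S : HTensor H 𝒢 →L[ℂ] HTensor H 𝒢') : Prop :=
  ∀ (l : Λ) (ξ : 𝒢), S (HTensor.tmul (kernelVec H l) ξ) =
    HTensor.tmul (kernelVec H l) ((G l).adjoint ξ)

/-- `G` is a multiplier: `k_l ⊗ ξ ↦ k_l ⊗ (G l)* ξ` extends to a bounded operator. -/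
def IsMultiplier (G : Λ → 𝒢' →L[ℂ] 𝒢) : Prop := ∃ S, IsMultiplierAdjoint H G S

/-- `G` is a contractive multiplier: `k_l ⊗ ξ ↦ k_l ⊗ (G l)* ξ` extends to a contraction. -/
def IsContractiveMultiplier (G : Λ → 𝒢' →L[ℂ] 𝒢) : Prop :=
  ∃ S, IsMultiplierAdjoint H G S ∧ ‖S‖ ≤ 1

open Classical in
/-- The multiplication operator `m_G : H ⊗ 𝒢' → H ⊗ 𝒢` of a multiplier `G`, the adjoint of the
bounded extension of `k_l ⊗ ξ ↦ k_l ⊗ (G l)* ξ`. (It is `0` if `G` is not a multiplier.) -/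
def mulOp (G : Λ → 𝒢' →L[ℂ] 𝒢) : HTensor H 𝒢' →L[ℂ] HTensor H 𝒢 :=
  if h : IsMultiplier H G then h.choose.adjoint else 0

theorem topologicalClosure_span_kernelVec :
    (Submodule.span ℂ (Set.range (kernelVec (Λ := Λ) H))).topologicalClosure = ⊤ := by
  rw [← RKHS.kerFun_dense H]
  congr 1
  refine le_antisymm (Submodule.span_mono ?_) (Submodule.span_le.2 ?_)
  · rintro _ ⟨l, rfl⟩
    exact ⟨l, 1, rfl⟩
  · rintro _ ⟨l, c, rfl⟩
    have : RKHS.kerFun H l c = c • kernelVec H l := by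
      rw [kernelVec, ← map_smul, smul_eq_mul, mul_one]
    rw [this]
    exact Submodule.smul_mem _ _ (Submodule.subset_span ⟨l, rfl⟩)

variable {H}

/-- The bounded extension of `k_l ⊗ ξ ↦ k_l ⊗ (G l)* ξ` is unique. -/
theorem IsMultiplierAdjoint.unique {G : Λ → 𝒢' →L[ℂ] 𝒢} {S T : HTensor H 𝒢 →L[ℂ] HTensor H 𝒢'}
    (hS : IsMultiplierAdjoint H G S) (hT : IsMultiplierAdjoint H G T) : S = T := by
  refine HTensor.ext_tmul fun x y => ?_
  have hcl : IsClosed {x : H | S (HTensor.tmul x y) = T (HTensor.tmul x y)} :=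
    isClosed_eq (S.continuous.comp (HTensor.continuous_tmul_left y))
      (T.continuous.comp (HTensor.continuous_tmul_left y))
  have hd : Dense (Submodule.span ℂ (Set.range (kernelVec (Λ := Λ) H)) : Set H) :=
    Submodule.dense_iff_topologicalClosure_eq_top.2 (topologicalClosure_span_kernelVec H)
  refine hcl.closure_subset_iff.2 (fun x hx => ?_) (hd x)
  induction hx using Submodule.span_induction with
  | mem x hx => obtain ⟨l, rfl⟩ := hx; exact (hS l y).trans (hT l y).symm
  | zero =>
    have h0 : HTensor.tmul (0 : H) y = 0 := by
      simpa using HTensor.tmul_smul_left (0 : ℂ) (0 : H) y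
    simp [h0]
  | add a b _ _ ha hb => simp_all [HTensor.tmul_add_left]
  | smul c a _ ha => simp_all [HTensor.tmul_smul_left]

theorem mulOp_eq {G : Λ → 𝒢' →L[ℂ] 𝒢} {S : HTensor H 𝒢 →L[ℂ] HTensor H 𝒢'}
    (hS : IsMultiplierAdjoint H G S) : mulOp H G = S.adjoint := by
  have h : IsMultiplier H G := ⟨S, hS⟩
  rw [mulOp, dif_pos h, h.choose_spec.unique hS]

end Multipliers

/-- The norm of the range space of `C : E → F`: `‖x‖_C = inf {‖y‖ : C y = x}`. -/
def rangeNorm {E F : Type*} [NormedAddCommGroup E] [InnerProductSpace ℂ E]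
    [NormedAddCommGroup F] [InnerProductSpace ℂ F] (C : E →L[ℂ] F) (x : F) : ℝ :=
  sInf {r : ℝ | ∃ y : E, C y = x ∧ ‖y‖ = r}

/-! ### Pick kernels -/

section Pick

variable {Λ : Type*}

/-- A Pick kernel: a positive definite kernel `K` such that for each base point `l₀` the function
`1 - K(m, l₀) K(l₀, l) / (K(m, l) K(l₀, l₀))` is again a positive definite kernel. Points `l` with
`K l l = 0`, at which all functions of the space vanish, are left aside; at the other points the
denominator must not vanish. -/
structure IsPickKernel (K : Λ → Λ → ℂ) : Prop where
  posSemidef : Matrix.PosSemidef (Matrix.of K)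
  ne_zero : ∀ m l, K m m ≠ 0 → K l l ≠ 0 → K m l ≠ 0
  pick : ∀ l₀, K l₀ l₀ ≠ 0 → Matrix.PosSemidef
    (Matrix.of fun m l : {l : Λ // K l l ≠ 0} =>
      1 - K m l₀ * K l₀ l / (K m l * K l₀ l₀))

variable (H : Type*) [NormedAddCommGroup H] [InnerProductSpace ℂ H] [CompleteSpace H]
  [RKHS ℂ H Λ ℂ]
  {𝓑 : Type*} [NormedAddCommGroup 𝓑] [InnerProductSpace ℂ 𝓑] [CompleteSpace 𝓑]

/-- The function `δ = k_{l₀} / ‖k_{l₀}‖`. -/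
def deltaVec (l₀ : Λ) : H := ((‖kernelVec H l₀‖⁻¹ : ℝ) : ℂ) • kernelVec H l₀

/-- `β : Λ → 𝓑` represents the Pick kernel `K` with base point `l₀`:
`K(m, l) = δ(m) conj(δ(l)) / (1 - ⟨β(l), β(m)⟩)` (the product `⟨·, ·⟩` being linear in its first
entry), and `𝓑` is minimal. -/
structure IsPickRepresentation (K : Λ → Λ → ℂ) (l₀ : Λ) (β : Λ → 𝓑) : Prop where
  base_ne_zero : K l₀ l₀ ≠ 0
  norm_lt_one : ∀ l, ‖β l‖ < 1
  eq_kernel : ∀ m l, K m l =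
    deltaVec H l₀ m * star (deltaVec H l₀ l) / (1 - inner ℂ (β m) (β l))
  minimal : (Submodule.span ℂ (Set.range β)).topologicalClosure = ⊤

/-- The operators `B(l) : 𝓑 → ℂ`, `B(l) ξ = ⟨ξ, β(l)⟩` (linear in `ξ`). -/
def rowB (β : Λ → 𝓑) (l : Λ) : 𝓑 →L[ℂ] ℂ := innerSL ℂ (β l)

/-- The operator `𝐁 = m_B`, regarded as an operator `𝓑 ⊗ H → H`. -/
def boldB (β : Λ → 𝓑) : HTensor 𝓑 H →L[ℂ] H :=
  (HTensor.rid H).toContinuousLinearEquiv.toContinuousLinearMap ∘L mulOp H (rowB β) ∘L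
    (HTensor.comm 𝓑 H).toContinuousLinearEquiv.toContinuousLinearMap

/-- The operator `𝐁 ⊗ I : 𝓑 ⊗ (H ⊗ 𝒢) ≅ (𝓑 ⊗ H) ⊗ 𝒢 → H ⊗ 𝒢`. -/
def boldBTensorId (𝒢 : Type*) [NormedAddCommGroup 𝒢] [InnerProductSpace ℂ 𝒢] (β : Λ → 𝓑) :
    HTensor 𝓑 (HTensor H 𝒢) →L[ℂ] HTensor H 𝒢 :=
  HTensor.map (boldB H β) (ContinuousLinearMap.id ℂ 𝒢) ∘L
    (HTensor.assoc 𝓑 H 𝒢).symm.toContinuousLinearEquiv.toContinuousLinearMap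

end Pick

/-! ### A Pick kernel has a representation -/

section Representation
variable {Λ : Type*} (H : Type*) [NormedAddCommGroup H] [InnerProductSpace ℂ H] [CompleteSpace H]
  [RKHS ℂ H Λ ℂ] {K : Λ → Λ → ℂ}

theorem HasKernel.inner_kernelVec {H : Type*} [NormedAddCommGroup H] [InnerProductSpace ℂ H]
    [CompleteSpace H] [RKHS ℂ H Λ ℂ] (hH : HasKernel H K) (m l : Λ) :
    inner ℂ (kernelVec H m) (kernelVec H l) = K m l := by
  rw [← hH m l, kernelVec, RKHS.kerFun_inner]
  simp [kernelVec]

/-- Every positive semidefinite kernel is a Gram kernel of a total family. -/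
theorem exists_gram {N : Type u} {F : N → N → ℂ} (hF : Matrix.PosSemidef (Matrix.of F)) :
    ∃ (𝓑 : Type u) (_ : NormedAddCommGroup 𝓑) (_ : InnerProductSpace ℂ 𝓑) (_ : CompleteSpace 𝓑)
      (b : N → 𝓑), (∀ m l, inner ℂ (b m) (b l) = F m l) ∧
        (Submodule.span ℂ (Set.range b)).topologicalClosure = ⊤ := by
  let K' : Matrix N N (ℂ →L[ℂ] ℂ) := Matrix.of fun m l => F m l • ContinuousLinearMap.id ℂ ℂ
  have hK' : K'.PosSemidef := by
    have hher : K'.IsHermitian := by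
      ext m l
      have := hF.isHermitian.apply m l
      simp only [Matrix.of_apply] at this
      simp [K', Matrix.conjTranspose_apply, star_smul, ContinuousLinearMap.star_eq_adjoint,
        ContinuousLinearMap.adjoint_id, ← this]
    have hpos : ∀ v : N →₀ ℂ, 0 ≤ RCLike.re (v.sum fun x w => v.sum fun x' w' =>
        inner ℂ (K' x' x w) w') := by
      intro v
      have h := (Complex.nonneg_iff.1 (hF.2 v)).1
      refine h.trans_eq ?_
      have hc : ∀ a b, (starRingEnd ℂ) (F a b) = F b a := fun a b => hF.isHermitian.apply b a
      simp [K', hc, mul_comm]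
    exact ((RKHS.posSemidef_tfae (K := K')).out 0 2).2 (And.intro hher hpos)
  have : Fact K'.PosSemidef := ⟨hK'⟩
  refine ⟨RKHS.OfKernel K', inferInstance, inferInstance, inferInstance,
    fun l => kernelVec (RKHS.OfKernel K') l, fun m l => ?_, ?_⟩
  · refine (RKHS.kernel_inner (RKHS.OfKernel K') l m (1 : ℂ) (1 : ℂ)).symm.trans ?_
    simpa [K'] using hF.isHermitian.apply m l
  · exact topologicalClosure_span_kernelVec _

/-- A Pick kernel has, for every base point, a representation through some `β`. -/
theorem IsPickKernel.exists_representation {Λ : Type u} {K : Λ → Λ → ℂ} (hK : IsPickKernel K)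
    (H : Type*) [NormedAddCommGroup H] [InnerProductSpace ℂ H] [CompleteSpace H] [RKHS ℂ H Λ ℂ]
    (hH : HasKernel H K) (l₀ : Λ) (h₀ : K l₀ l₀ ≠ 0) :
    ∃ (𝓑 : Type u) (_ : NormedAddCommGroup 𝓑) (_ : InnerProductSpace ℂ 𝓑) (_ : CompleteSpace 𝓑)
      (β : Λ → 𝓑), IsPickRepresentation H K l₀ β := by
  classical
  obtain ⟨𝓑, i1, i2, i3, b, hb, hd⟩ := exists_gram (hK.pick l₀ h₀)
  have hin := hH.inner_kernelVec
  have hz : ∀ l, K l l = 0 → kernelVec H l = 0 := fun l hl =>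
    inner_self_eq_zero.1 ((hin l l).trans hl)
  have hconj : ∀ m l, star (K m l) = K l m := fun m l => by
    rw [← hin m l, ← hin l m]; exact inner_conj_symm _ _
  have hdel : ∀ m l, deltaVec H l₀ m * star (deltaVec H l₀ l) = K m l₀ * K l₀ l / K l₀ l₀ := by
    intro m l
    have h2 : K l₀ l₀ = (‖kernelVec H l₀‖ : ℂ) ^ 2 := by
      rw [← hin l₀ l₀]; exact inner_self_eq_norm_sq_to_K _
    have h3 : (‖kernelVec H l₀‖ : ℂ) ≠ 0 := fun h => h₀ (by rw [h2, h]; simp)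
    simp only [deltaVec, RKHS.coe_smul, Pi.smul_apply, hH m l₀, hH l l₀, smul_eq_mul, star_mul',
      hconj l l₀]
    rw [h2]
    simp
    field_simp
  refine ⟨𝓑, i1, i2, i3, fun l => if h : K l l ≠ 0 then b ⟨l, h⟩ else 0, ⟨h₀, fun l => ?_,
    fun m l => ?_, ?_⟩⟩
  · by_cases h : K l l = 0
    · simp [h]
    · simp only [ne_eq, h, not_false_eq_true, dite_true]
      have h1 := hb ⟨l, h⟩ ⟨l, h⟩
      have hne := hK.ne_zero l l₀ h h₀
      have e1 : K l l = ((‖kernelVec H l‖ ^ 2 : ℝ) : ℂ) := by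
        rw [← hin l l]; push_cast; exact inner_self_eq_norm_sq_to_K _
      have e2 : K l₀ l₀ = ((‖kernelVec H l₀‖ ^ 2 : ℝ) : ℂ) := by
        rw [← hin l₀ l₀]; push_cast; exact inner_self_eq_norm_sq_to_K _
      have e3 : K l l₀ * K l₀ l = ((‖K l l₀‖ ^ 2 : ℝ) : ℂ) := by
        rw [← hconj l l₀]; push_cast; exact Complex.mul_conj' _
      rw [inner_self_eq_norm_sq_to_K, e3, e1, e2] at h1
      have h1' : ‖b ⟨l, h⟩‖ ^ 2 =
          1 - ‖K l l₀‖ ^ 2 / (‖kernelVec H l‖ ^ 2 * ‖kernelVec H l₀‖ ^ 2) := by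
        refine Complex.ofReal_injective ?_
        push_cast
        push_cast at h1
        exact h1
      have p1 : 0 < ‖kernelVec H l‖ := norm_pos_iff.2 fun h' => h (by rw [e1, h']; simp)
      have p2 : 0 < ‖kernelVec H l₀‖ := norm_pos_iff.2 fun h' => h₀ (by rw [e2, h']; simp)
      have p3 : 0 < ‖K l l₀‖ := norm_pos_iff.2 hne
      have p4 : 0 < ‖K l l₀‖ ^ 2 / (‖kernelVec H l‖ ^ 2 * ‖kernelVec H l₀‖ ^ 2) := by positivity
      nlinarith [norm_nonneg (b ⟨l, h⟩)]
  · rw [hdel]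
    by_cases hm : K m m = 0
    · rw [← hin m l, ← hin m l₀, hz m hm]; simp
    by_cases hl : K l l = 0
    · rw [← hin m l, ← hin l₀ l, hz l hl]; simp
    simp only [ne_eq, hm, hl, not_false_eq_true, dite_true]
    rw [hb ⟨m, hm⟩ ⟨l, hl⟩]
    have := hK.ne_zero m l hm hl
    have := hK.ne_zero m l₀ hm h₀
    have := hK.ne_zero l₀ l h₀ hl
    rw [sub_sub_cancel]
    field_simp
  · rw [eq_top_iff, ← hd]
    refine Submodule.topologicalClosure_mono (Submodule.span_mono ?_)
    rintro _ ⟨⟨l, h⟩, rfl⟩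
    exact ⟨l, by simp [h]⟩

end Representation

end

/-! Write `P` for the projection onto `M`, `D` for `𝐁 ⊗ I`, and `δ` for `deltaVec H l₀`. The kernel
identity makes `k_l ↦ β(l) ⊗ k_l` a contraction (`IsPickRepresentation.exists_contraction`) whose
adjoint is `𝐁` (`boldB_eq_adjoint`). Hence `D` is a contraction and `D†(k_l ⊗ ξ) = β(l) ⊗ k_l ⊗ ξ`.
Since `D` maps `𝓑 ⊗ M` into `M`, the operator `Q = P - D (I ⊗ P) D†` is positive
(`nonneg_starProjection_sub`). Between the vectors `k_m ⊗ η` and `k_l ⊗ ξ`, its matrix entry is that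
of `P` times `1 - ⟪β(m), β(l)⟫`.

On the other hand `1 - ⟪β(m), β(l)⟫ = δ(m) conj(δ(l)) / K(m, l)`. So with `A(l) ξ = conj(δ(l))⁻¹
Q^{1/2} (k_l ⊗ ξ)`, the number `K(m, l) ⟪A(m) η, A(l) ξ⟫` is the matrix entry of `P`. In other
words, the vectors `k_l ⊗ A(l) ξ` have the Gram kernel that `P` induces on the total family `k_l ⊗
ξ`. By `exists_clm_of_inner_eq` there is a bounded `S : k_l ⊗ ξ ↦ k_l ⊗ A(l) ξ` with `S†S = P`. Then
`G = A†` is the multiplier and `m_G = S†`; range and norms follow from `S†S = P` alone. -/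

/-! ### Operators determined by Gram kernels. -/

section Family

variable {E F : Type*} [NormedAddCommGroup E] [InnerProductSpace ℂ E] [CompleteSpace E]
  [NormedAddCommGroup F] [InnerProductSpace ℂ F] [CompleteSpace F]

open ContinuousLinearMap in
/-- A bounded operator `S` with prescribed `S†S` and prescribed values on a total family exists
as soon as the Gram kernels match. -/
theorem exists_clm_of_inner_eq {ι : Type*} {v : ι → E} (w : ι → F)
    (hv : (Submodule.span ℂ (Set.range v)).topologicalClosure = ⊤) (P : E →L[ℂ] E)
    (h : ∀ i j, inner ℂ (w i) (w j) = inner ℂ (v i) (P (v j))) :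
    ∃ S : E →L[ℂ] F, (∀ i, S (v i) = w i) ∧ S.adjoint ∘L S = P := by
  set e := Finsupp.linearCombination ℂ v with he
  set f := Finsupp.linearCombination ℂ w with hf
  have hd : DenseRange e := by
    rw [← Submodule.dense_iff_topologicalClosure_eq_top, ← Finsupp.range_linearCombination] at hv
    exact hv
  have hin : ∀ x y, inner ℂ (f x) (f y) = inner ℂ (e x) (P (e y)) := by
    intro x y
    simp only [he, hf, Finsupp.linearCombination_apply, Finsupp.sum, map_sum, map_smul, sum_inner,
      inner_sum, inner_smul_left, inner_smul_right, h]
  -- By `hin`, `‖f x‖² = ⟪e x, P (e x)⟫`. The resulting bound gives both existence and continuity of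
  -- `S`: every linear relation among the `v i` also holds among the `w i`.
  have hb : ∀ x, ‖f x‖ ≤ Real.sqrt ‖P‖ * ‖e x‖ := by
    intro x
    refine le_of_sq_le_sq ?_ (by positivity)
    rw [mul_pow, Real.sq_sqrt (norm_nonneg _), ← inner_self_eq_norm_sq (𝕜 := ℂ), hin]
    calc RCLike.re (inner ℂ (e x) (P (e x))) ≤ ‖e x‖ * ‖P (e x)‖ := re_inner_le_norm _ _
      _ ≤ ‖e x‖ * (‖P‖ * ‖e x‖) := by gcongr; exact P.le_opNorm _
      _ = ‖P‖ * ‖e x‖ ^ 2 := by ring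
  have hS : ∀ x, f.extendOfNorm e (e x) = f x := LinearMap.extendOfNorm_eq hd ⟨_, hb⟩
  refine ⟨f.extendOfNorm e, fun i => ?_, ?_⟩
  · simpa [he, hf] using hS (Finsupp.single i 1)
  · refine ContinuousLinearMap.ext fun y => ?_
    refine hd.induction_on (p := fun y => (_ : E →L[ℂ] E) y = P y) y
      (isClosed_eq (ContinuousLinearMap.continuous _) P.continuous) fun y => ?_
    refine hd.eq_of_inner_right ℂ fun x => ?_
    rw [comp_apply, adjoint_inner_right, hS, hS, hin]

end Family

/-! ### Norms and adjoints of tensor products of operators. -/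

namespace HTensor

variable {E F E' F' : Type*}
  [NormedAddCommGroup E] [InnerProductSpace ℂ E] [NormedAddCommGroup F] [InnerProductSpace ℂ F]
  [NormedAddCommGroup E'] [InnerProductSpace ℂ E'] [NormedAddCommGroup F'] [InnerProductSpace ℂ F']

theorem tmul_add_right (x : E) (y y' : F) : tmul x (y + y') = tmul x y + tmul x y' := by
  rw [tmul, TensorProduct.tmul_add]; exact UniformSpace.Completion.coe_add _ _

theorem tmul_smul_right (c : ℂ) (x : E) (y : F) : tmul x (c • y) = c • tmul x y := by
  rw [tmul, TensorProduct.tmul_smul]; exact UniformSpace.Completion.coe_smul _ _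

theorem zero_tmul (y : F) : tmul (0 : E) y = 0 := by
  simpa using tmul_smul_left (0 : ℂ) (0 : E) y

/-- The bounded operator `y ↦ x ⊗ y`. -/
noncomputable def tmulL (F : Type*) [NormedAddCommGroup F] [InnerProductSpace ℂ F] (x : E) :
    F →L[ℂ] HTensor E F where
  toFun := tmul x
  map_add' := tmul_add_right x
  map_smul' c y := tmul_smul_right c x y
  cont := continuous_tmul_right x

@[simp]
theorem tmulL_apply (x : E) (y : F) : tmulL F x y = tmul x y := rfl

theorem norm_map_le (f : E →L[ℂ] E') (g : F →L[ℂ] F') : ‖map f g‖ ≤ ‖f‖ * ‖g‖ := by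
  refine ContinuousLinearMap.opNorm_le_bound _ (by positivity) fun z => ?_
  induction z using UniformSpace.Completion.induction_on with
  | hp => exact isClosed_le (by fun_prop) (by fun_prop)
  | ih a =>
    have h : map f g a = ((TensorProduct.mapL f g a : E' ⊗[ℂ] F') : HTensor E' F') :=
      ContinuousLinearMap.extend_eq _ denseRange_toComplL isUniformInducing_toComplL a
    rw [h, UniformSpace.Completion.norm_coe, UniformSpace.Completion.norm_coe]
    exact (TensorProduct.mapL f g).le_of_opNorm_le (TensorProduct.norm_mapL_le f g) a

theorem map_comp_map {E'' F'' : Type*} [NormedAddCommGroup E''] [InnerProductSpace ℂ E'']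
    [NormedAddCommGroup F''] [InnerProductSpace ℂ F''] (f' : E' →L[ℂ] E'') (g' : F' →L[ℂ] F'')
    (f : E →L[ℂ] E') (g : F →L[ℂ] F') : map f' g' ∘L map f g = map (f' ∘L f) (g' ∘L g) :=
  ext_tmul fun x y => by simp [map_tmul]

theorem dense_span_tmul :
    Dense (Submodule.span ℂ {z : HTensor E F | ∃ x y, tmul x y = z} : Set (HTensor E F)) :=
  Submodule.dense_iff_topologicalClosure_eq_top.2 topologicalClosure_span_tmul

/-- Two vectors with the same inner products against all simple tensors are equal. -/
theorem eq_of_inner_tmul {a b : HTensor E F}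
    (h : ∀ x y, inner ℂ (tmul x y) a = inner ℂ (tmul x y) b) : a = b := by
  refine dense_span_tmul.eq_of_inner_right ℂ fun z hz => ?_
  induction hz using Submodule.span_induction with
  | mem z hz => obtain ⟨x, y, rfl⟩ := hz; exact h x y
  | zero => simp
  | add z z' _ _ hz hz' => simp [inner_add_left, hz, hz']
  | smul c z _ hz => simp [inner_smul_left, hz]

theorem adjoint_map [CompleteSpace E] [CompleteSpace F] [CompleteSpace E'] [CompleteSpace F']
    (f : E →L[ℂ] E') (g : F →L[ℂ] F') : (map f g).adjoint = map f.adjoint g.adjoint := by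
  refine ext_tmul fun x y => eq_of_inner_tmul fun x' y' => ?_
  simp only [ContinuousLinearMap.adjoint_inner_right, map_tmul, inner_tmul]

end HTensor

/-! ### Totality of the kernel tensors. -/

section Total

variable {Λ : Type*} (H : Type*) [NormedAddCommGroup H] [InnerProductSpace ℂ H] [CompleteSpace H]
  [RKHS ℂ H Λ ℂ] (𝒢 : Type*) [NormedAddCommGroup 𝒢] [InnerProductSpace ℂ 𝒢]

/-- The tensors `k_l ⊗ ξ` are total. -/
theorem topologicalClosure_span_kernelVec_tmul :
    (Submodule.span ℂ (Set.range fun p : Λ × 𝒢 =>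
      HTensor.tmul (kernelVec H p.1) p.2)).topologicalClosure = ⊤ := by
  rw [eq_top_iff, ← HTensor.topologicalClosure_span_tmul]
  refine Submodule.topologicalClosure_minimal _ (Submodule.span_le.2 ?_)
    (Submodule.isClosed_topologicalClosure _)
  rintro _ ⟨x, y, rfl⟩
  have hcl : IsClosed {x : H | HTensor.tmul x y ∈ (Submodule.span ℂ (Set.range
      fun p : Λ × 𝒢 => HTensor.tmul (kernelVec H p.1) p.2)).topologicalClosure} :=
    (Submodule.isClosed_topologicalClosure _).preimage (HTensor.continuous_tmul_left y)
  have hd : Dense (Submodule.span ℂ (Set.range (kernelVec (Λ := Λ) H)) : Set H) :=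
    Submodule.dense_iff_topologicalClosure_eq_top.2 (topologicalClosure_span_kernelVec H)
  refine hcl.closure_subset_iff.2 (fun x hx => ?_) (hd x)
  induction hx using Submodule.span_induction with
  | mem x hx =>
    obtain ⟨l, rfl⟩ := hx
    exact Submodule.le_topologicalClosure _ (Submodule.subset_span ⟨(l, y), rfl⟩)
  | zero => simp [HTensor.zero_tmul]
  | add a b _ _ ha hb =>
    rw [Set.mem_ofPred_eq, HTensor.tmul_add_left]; exact Submodule.add_mem _ ha hb
  | smul c a _ ha =>
    rw [Set.mem_ofPred_eq, HTensor.tmul_smul_left]; exact Submodule.smul_mem _ c ha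

end Total

/-! ### The row operator `𝐁` and its adjoint. -/

section RowOperator

variable {Λ : Type*} {H : Type*} [NormedAddCommGroup H] [InnerProductSpace ℂ H] [CompleteSpace H]
  [RKHS ℂ H Λ ℂ]
  {𝓑 : Type*} [NormedAddCommGroup 𝓑] [InnerProductSpace ℂ 𝓑]
  {K : Λ → Λ → ℂ} {l₀ : Λ} {β : Λ → 𝓑}

theorem inner_kernelVec_left (l : Λ) (f : H) : inner ℂ (kernelVec H l) f = f l := by
  rw [kernelVec, RKHS.kerFun_inner]; simp

/-- Cauchy–Schwarz with `‖β‖ < 1`. This makes the quotient in the kernel formula a genuine one. -/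
theorem IsPickRepresentation.one_sub_inner_ne_zero (hβ : IsPickRepresentation H K l₀ β)
    (m l : Λ) : 1 - inner ℂ (β m) (β l) ≠ 0 := by
  intro h
  have h1 : ‖inner ℂ (β m) (β l)‖ = 1 := by rw [← sub_eq_zero.1 h, norm_one]
  have h2 := norm_inner_le_norm (𝕜 := ℂ) (β m) (β l)
  nlinarith [hβ.norm_lt_one m, hβ.norm_lt_one l, norm_nonneg (β m), norm_nonneg (β l)]

theorem IsPickRepresentation.kernel_mul (hβ : IsPickRepresentation H K l₀ β) (m l : Λ) :
    K m l * (1 - inner ℂ (β m) (β l)) = deltaVec H l₀ m * star (deltaVec H l₀ l) := by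
  rw [hβ.eq_kernel, div_mul_cancel₀ _ (hβ.one_sub_inner_ne_zero m l)]

/-- If `δ` vanishes at `l`, then so does every function of the space. -/
theorem IsPickRepresentation.kernelVec_eq_zero (hβ : IsPickRepresentation H K l₀ β)
    (hH : HasKernel H K) {l : Λ} (hl : deltaVec H l₀ l = 0) : kernelVec H l = 0 := by
  rw [← inner_self_eq_zero (𝕜 := ℂ), hH.inner_kernelVec, hβ.eq_kernel, hl]
  simp

open ContinuousLinearMap in
/-- The contraction `k_l ↦ β(l) ⊗ k_l`. -/
theorem IsPickRepresentation.exists_contraction [CompleteSpace 𝓑] (hβ : IsPickRepresentation H K l₀ β)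
    (hH : HasKernel H K) :
    ∃ T : H →L[ℂ] HTensor 𝓑 H,
      (∀ l, T (kernelVec H l) = HTensor.tmul (β l) (kernelVec H l)) ∧ ‖T‖ ≤ 1 := by
  set d := deltaVec H l₀ with hd
  obtain ⟨T, hT, hTT⟩ := exists_clm_of_inner_eq
    (fun l => HTensor.tmul (β l) (kernelVec H l)) (topologicalClosure_span_kernelVec H)
    -- Clearing the denominator in the kernel formula gives `⟪β(m), β(l)⟫ K(m, l) = K(m, l) - δ(m)
    -- conj(δ(l))`. Hence `T†T` must be the identity minus the rank-one operator `x ↦ ⟪d, x⟫ d`, and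
    -- `‖T x‖² = ‖x‖² - |⟪d, x⟫|²`.
    (ContinuousLinearMap.id ℂ H - (innerSL ℂ d).smulRight d) (fun m l => by
      have h1 : inner ℂ d (kernelVec H l) = star (d l) := by
        rw [← inner_kernelVec_left]; exact (inner_conj_symm _ _).symm
      have h2 := hβ.kernel_mul m l
      rw [HTensor.inner_tmul, hH.inner_kernelVec]
      simp only [sub_apply, ContinuousLinearMap.id_apply, smulRight_apply,
        innerSL_apply_apply, inner_sub_right, inner_smul_right, h1, hH.inner_kernelVec,
        inner_kernelVec_left]
      linear_combination -h2)
  refine ⟨T, hT, T.opNorm_le_bound zero_le_one fun x => ?_⟩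
  rw [one_mul]
  refine le_of_sq_le_sq ?_ (norm_nonneg _)
  rw [apply_norm_sq_eq_inner_adjoint_right, hTT]
  have h : inner ℂ x d * inner ℂ d x = ((‖inner ℂ d x‖ ^ 2 : ℝ) : ℂ) := by
    rw [← inner_conj_symm x d]; push_cast; exact Complex.conj_mul' _
  simp only [sub_apply, ContinuousLinearMap.id_apply, smulRight_apply,
    innerSL_apply_apply, inner_sub_right, inner_smul_right, map_sub, mul_comm (inner ℂ d x), h]
  rw [inner_self_eq_norm_sq]
  have : RCLike.re (((‖inner ℂ d x‖ ^ 2 : ℝ) : ℂ)) = ‖inner ℂ d x‖ ^ 2 := RCLike.ofReal_re _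
  rw [this]
  nlinarith [sq_nonneg ‖inner ℂ d x‖]

open ContinuousLinearMap in
/-- `𝐁` is the adjoint of `k_l ↦ β(l) ⊗ k_l`. -/
theorem boldB_eq_adjoint [CompleteSpace 𝓑] {T : H →L[ℂ] HTensor 𝓑 H}
    (hT : ∀ l, T (kernelVec H l) = HTensor.tmul (β l) (kernelVec H l)) :
    boldB H β = T.adjoint := by
  -- Up to the swap and `H ⊗ ℂ ≅ H`, `T` is the map defining the multiplier, because `B(l)† c = c
  -- β(l)`.
  have hS : IsMultiplierAdjoint H (rowB β)
      ((HTensor.comm 𝓑 H).toContinuousLinearEquiv.toContinuousLinearMap ∘L T ∘L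
        (HTensor.rid H).toContinuousLinearEquiv.toContinuousLinearMap) := by
    intro l c
    have h : (rowB β l).adjoint c = c • β l := by rw [rowB, adjoint_innerSL_apply]; simp
    simp [h, HTensor.rid_tmul, hT, HTensor.comm_tmul, HTensor.tmul_smul_right]
  rw [boldB, mulOp_eq hS]
  refine ContinuousLinearMap.ext fun x => ext_inner_left ℂ fun y => ?_
  simp only [comp_apply, adjoint_inner_right]
  have h1 : ∀ z, inner ℂ y ((HTensor.rid H) z) = inner ℂ ((HTensor.rid H).symm y) z := fun z => by
    rw [← (HTensor.rid H).inner_map_map, LinearIsometryEquiv.apply_symm_apply]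
  refine (h1 _).trans ?_
  rw [adjoint_inner_right]
  simp

end RowOperator

/-! ### The operator `𝐁 ⊗ I` on kernel tensors. -/

section TensorId

variable {Λ : Type*} {H : Type*} [NormedAddCommGroup H] [InnerProductSpace ℂ H] [CompleteSpace H]
  [RKHS ℂ H Λ ℂ]
  {𝓑 : Type*} [NormedAddCommGroup 𝓑] [InnerProductSpace ℂ 𝓑] [CompleteSpace 𝓑]
  {𝒢 : Type*} [NormedAddCommGroup 𝒢] [InnerProductSpace ℂ 𝒢] {β : Λ → 𝓑}

theorem norm_boldBTensorId_le (h : ‖boldB H β‖ ≤ 1) : ‖boldBTensorId H 𝒢 β‖ ≤ 1 := by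
  refine ContinuousLinearMap.opNorm_le_bound _ zero_le_one fun x => ?_
  have h1 : ‖HTensor.map (boldB H β) (ContinuousLinearMap.id ℂ 𝒢)‖ ≤ 1 :=
    (HTensor.norm_map_le _ _).trans
      (mul_le_one₀ h (norm_nonneg _) ContinuousLinearMap.norm_id_le)
  refine (ContinuousLinearMap.le_of_opNorm_le _ h1 ((HTensor.assoc 𝓑 H 𝒢).symm x)).trans ?_
  rw [LinearIsometryEquiv.norm_map]

open ContinuousLinearMap in
-- The source of the factor `⟪β(m), β(l)⟫` in the matrix entries of `D (I ⊗ P) D†`.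
theorem adjoint_boldBTensorId_tmul [CompleteSpace 𝒢] {T : H →L[ℂ] HTensor 𝓑 H}
    (hT : ∀ l, T (kernelVec H l) = HTensor.tmul (β l) (kernelVec H l)) (l : Λ) (ξ : 𝒢) :
    (boldBTensorId H 𝒢 β).adjoint (HTensor.tmul (kernelVec H l) ξ) =
      HTensor.tmul (β l) (HTensor.tmul (kernelVec H l) ξ) := by
  refine ext_inner_right ℂ fun y => ?_
  rw [adjoint_inner_left, boldBTensorId, boldB_eq_adjoint hT]
  simp only [comp_apply]
  rw [← adjoint_inner_left, HTensor.adjoint_map, HTensor.map_tmul, adjoint_adjoint, hT,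
    adjoint_id, ContinuousLinearMap.id_apply, ← HTensor.assoc_tmul,
    ← (HTensor.assoc 𝓑 H 𝒢).inner_map_map]
  simp

end TensorId

/-! ### Invariance and positivity; factorizations of a projection. -/

section Projection

variable {E X : Type*} [NormedAddCommGroup E] [InnerProductSpace ℂ E] [CompleteSpace E]
  [NormedAddCommGroup X] [InnerProductSpace ℂ X] [CompleteSpace X]

open ContinuousLinearMap

/-- If a contraction `D : E ⊗ X → X` maps `E ⊗ M` to `M`, then `P - D (I ⊗ P) D†` is positive for
the projection `P` onto `M`. -/
theorem nonneg_starProjection_sub (D : HTensor E X →L[ℂ] X) (hD : ‖D‖ ≤ 1)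
    (M : Submodule ℂ X) [M.HasOrthogonalProjection]
    (hM : ∀ x ∈ HTensor.tensorSubspace E M, D x ∈ M) :
    0 ≤ M.starProjection -
      D ∘L HTensor.map (ContinuousLinearMap.id ℂ E) M.starProjection ∘L D.adjoint := by
  set P := M.starProjection with hP
  set R := HTensor.map (ContinuousLinearMap.id ℂ E) P with hR
  have hPa : P.adjoint = P := (isSelfAdjoint_starProjection M).adjoint_eq
  have hRa : R.adjoint = R := by rw [hR, HTensor.adjoint_map, adjoint_id, hPa]
  have hRR : R ∘L R = R := by
    rw [hR, HTensor.map_comp_map]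
    congr 1
    exact M.isIdempotentElem_starProjection
  have hRn : ‖R‖ ≤ 1 := (HTensor.norm_map_le _ _).trans
    (mul_le_one₀ ContinuousLinearMap.norm_id_le (norm_nonneg _) M.starProjection_norm_le)
  have hfac : R = HTensor.map (ContinuousLinearMap.id ℂ E) M.subtypeL ∘L
      HTensor.map (ContinuousLinearMap.id ℂ E) M.orthogonalProjectionOnto := by
    rw [HTensor.map_comp_map]; rfl
  -- The only use of invariance: `R` has its range in `E ⊗ M`, so `D R` has its range in `M`.
  have hPDR : P ∘L D ∘L R = D ∘L R := by
    ext x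
    refine Submodule.starProjection_eq_self_iff.2 (hM _ ?_)
    rw [hfac]
    exact ⟨_, rfl⟩
  have hRDP : R ∘L D.adjoint ∘L P = R ∘L D.adjoint := by
    simpa [adjoint_comp, hPa, hRa, comp_assoc] using congrArg adjoint hPDR
  have hin : ∀ x, inner ℂ ((P - D ∘L R ∘L D.adjoint) x) x =
      ((‖P x‖ ^ 2 - ‖R (D.adjoint x)‖ ^ 2 : ℝ) : ℂ) := by
    intro x
    have h1 : inner ℂ (P x) x = (‖P x‖ : ℂ) ^ 2 := by
      have : P (P x) = P x := DFunLike.congr_fun M.isIdempotentElem_starProjection x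
      refine Eq.trans ?_ (inner_self_eq_norm_sq_to_K (P x))
      rw [← adjoint_inner_left P, hPa, this]
    have h2 : inner ℂ (D (R (D.adjoint x))) x = (‖R (D.adjoint x)‖ : ℂ) ^ 2 := by
      have : R (R (D.adjoint x)) = R (D.adjoint x) := DFunLike.congr_fun hRR _
      refine Eq.trans ?_ (inner_self_eq_norm_sq_to_K (R (D.adjoint x)))
      rw [← adjoint_inner_left R, hRa, this, adjoint_inner_right]
    simp only [sub_apply, comp_apply, inner_sub_left, h1, h2]
    push_cast
    rfl
  rw [nonneg_iff_isPositive, isPositive_iff_complex]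
  intro x
  rw [hin]
  refine ⟨congrArg _ (RCLike.ofReal_re _), ?_⟩
  refine le_of_le_of_eq (sub_nonneg.2 ?_) (RCLike.ofReal_re (K := ℂ) _).symm
  -- The adjoint form of invariance lets `x` be replaced by `P x`, so contractivity yields the bound
  -- `‖P x‖` rather than just `‖x‖`.
  have h3 : R (D.adjoint x) = R (D.adjoint (P x)) := (DFunLike.congr_fun hRDP x).symm
  have hDa : ‖D.adjoint‖ ≤ 1 := by rwa [LinearIsometryEquiv.norm_map]
  gcongr
  rw [h3]
  calc ‖R (D.adjoint (P x))‖ ≤ 1 * ‖D.adjoint (P x)‖ := R.le_of_opNorm_le hRn _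
    _ ≤ 1 * (1 * ‖P x‖) := by gcongr; exact D.adjoint.le_of_opNorm_le hDa _
    _ = ‖P x‖ := by ring

/-- If `S†S` is the projection onto `M`, then `S` is a contraction. -/
theorem norm_le_one_of_adjoint_comp_self {F : Type*} [NormedAddCommGroup F]
    [InnerProductSpace ℂ F] [CompleteSpace F] {S : X →L[ℂ] F} {M : Submodule ℂ X}
    [M.HasOrthogonalProjection] (hS : S.adjoint ∘L S = M.starProjection) : ‖S‖ ≤ 1 := by
  -- The C*-identity: `‖S‖² = ‖S†S‖ ≤ 1`.
  have h := norm_adjoint_comp_self S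
  rw [hS] at h
  nlinarith [M.starProjection_norm_le, norm_nonneg S]

/-- If `S†S` is the projection onto `M`, then the range of `S†` is `M`. -/
theorem range_adjoint_of_adjoint_comp_self {F : Type*} [NormedAddCommGroup F]
    [InnerProductSpace ℂ F] [CompleteSpace F] {S : X →L[ℂ] F} {M : Submodule ℂ X}
    [M.HasOrthogonalProjection] (hS : S.adjoint ∘L S = M.starProjection) :
    LinearMap.range S.adjoint.toLinearMap = M := by
  apply le_antisymm
  · rintro _ ⟨y, rfl⟩
    change S.adjoint y ∈ M
    rw [← M.orthogonal_orthogonal, Submodule.mem_orthogonal]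
    intro x hx
    -- `S†S` and `S` have the same kernel, so `S` vanishes on the orthogonal complement of `M`.
    have h : S x = 0 := by
      have hk : x ∈ (S.adjoint ∘L S).ker := by
        rw [hS]; exact (Submodule.starProjection_apply_eq_zero_iff M).2 hx
      rw [S.ker_adjoint_comp_self] at hk
      exact hk
    rw [adjoint_inner_right, h, inner_zero_left]
  · intro x hx
    refine ⟨S x, ?_⟩
    exact (DFunLike.congr_fun hS x).trans (Submodule.starProjection_eq_self_iff.2 hx)

/-- If `S†S` is the projection onto `M`, then the range norm of `S†` is the norm of `M`. -/
theorem rangeNorm_adjoint_of_adjoint_comp_self {F : Type*} [NormedAddCommGroup F]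
    [InnerProductSpace ℂ F] [CompleteSpace F] {S : X →L[ℂ] F} {M : Submodule ℂ X}
    [M.HasOrthogonalProjection] (hS : S.adjoint ∘L S = M.starProjection) {x : X} (hx : x ∈ M) :
    rangeNorm S.adjoint x = ‖x‖ := by
  have h1 := norm_le_one_of_adjoint_comp_self hS
  have h2 : S.adjoint (S x) = x :=
    (DFunLike.congr_fun hS x).trans (Submodule.starProjection_eq_self_iff.2 hx)
  have h3 : ∀ y, ‖S.adjoint y‖ ≤ ‖y‖ := fun y => by
    simpa using S.adjoint.le_of_opNorm_le ((LinearIsometryEquiv.norm_map _ S).trans_le h1) y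
  -- The infimum is attained at `S x`: both `S` and `S†` are contractions and `S†(S x) = x`, so `‖S
  -- x‖ = ‖x‖`.
  refine IsLeast.csInf_eq ⟨⟨S x, h2, le_antisymm ?_ ?_⟩, ?_⟩
  · simpa using S.le_of_opNorm_le h1 x
  · simpa only [h2] using h3 (S x)
  · rintro _ ⟨y, rfl, rfl⟩
    exact h3 y

end Projection

/-! ### Construction of the multiplier. -/

theorem mainTheorem5 {Λ : Type*}
    (K : Λ → Λ → ℂ) (hK : IsPickKernel K)
    (H : Type u) [NormedAddCommGroup H] [InnerProductSpace ℂ H] [CompleteSpace H]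
    [RKHS ℂ H Λ ℂ] (hH : HasKernel H K)
    (l₀ : Λ)
    (𝓑 : Type*) [NormedAddCommGroup 𝓑] [InnerProductSpace ℂ 𝓑] [CompleteSpace 𝓑]
    (β : Λ → 𝓑) (hβ : IsPickRepresentation H K l₀ β)
    (𝒢 : Type v) [NormedAddCommGroup 𝒢] [InnerProductSpace ℂ 𝒢] [CompleteSpace 𝒢]
    (M : ClosedSubmodule ℂ (HTensor H 𝒢))
    (hM : ∀ x ∈ HTensor.tensorSubspace 𝓑 M.toSubmodule, boldBTensorId H 𝒢 β x ∈ M) :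
    ∃ (𝒢' : Type (max u v)) (_ : NormedAddCommGroup 𝒢') (_ : InnerProductSpace ℂ 𝒢')
      (_ : CompleteSpace 𝒢') (G : Λ → 𝒢' →L[ℂ] 𝒢),
      IsContractiveMultiplier H G ∧
      mulOp H G ∘L (mulOp H G).adjoint = M.toSubmodule.starProjection ∧
      LinearMap.range (mulOp H G).toLinearMap = M.toSubmodule ∧
      ∀ x ∈ M, rangeNorm (mulOp H G) x = ‖x‖ := by
  obtain ⟨T, hT, hTn⟩ := hβ.exists_contraction hH
  set D := boldBTensorId H 𝒢 β with hD
  have hDn : ‖D‖ ≤ 1 := norm_boldBTensorId_le (by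
    rwa [boldB_eq_adjoint hT, LinearIsometryEquiv.norm_map])
  set P := M.toSubmodule.starProjection with hP
  have hQ := nonneg_starProjection_sub D hDn M.toSubmodule hM
  set Q := P - D ∘L HTensor.map (ContinuousLinearMap.id ℂ 𝓑) P ∘L D.adjoint with hQdef
  set r := CFC.sqrt Q with hr
  have hrr : r * r = Q := CFC.sqrt_mul_sqrt_self Q hQ
  have hra : r.adjoint = r := (IsSelfAdjoint.of_nonneg (CFC.sqrt_nonneg Q)).adjoint_eq
  have hQin : ∀ m l (η ξ : 𝒢), inner ℂ (HTensor.tmul (kernelVec H m) η)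
      (Q (HTensor.tmul (kernelVec H l) ξ)) = (1 - inner ℂ (β m) (β l)) *
        inner ℂ (HTensor.tmul (kernelVec H m) η) (P (HTensor.tmul (kernelVec H l) ξ)) := by
    intro m l η ξ
    simp only [hQdef, sub_apply, ContinuousLinearMap.comp_apply,
      inner_sub_right]
    rw [← ContinuousLinearMap.adjoint_inner_left D, adjoint_boldBTensorId_tmul hT,
      adjoint_boldBTensorId_tmul hT, HTensor.map_tmul, HTensor.inner_tmul]
    simp only [ContinuousLinearMap.id_apply]
    ring
  set d := deltaVec H l₀ with hd
  -- Where `d l = 0` the inverse is `0` and so is `A l`; this is harmless because `k_l = 0` there.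
  let A : Λ → 𝒢 →L[ℂ] HTensor H 𝒢 := fun l =>
    (star (d l))⁻¹ • (r ∘L HTensor.tmulL 𝒢 (kernelVec H l))
  have hA : ∀ m l (η ξ : 𝒢), inner ℂ (A m η) (A l ξ) = (d m)⁻¹ * (star (d l))⁻¹ *
      inner ℂ (HTensor.tmul (kernelVec H m) η) (Q (HTensor.tmul (kernelVec H l) ξ)) := by
    intro m l η ξ
    rw [← hrr, mul_apply_eq_comp, ← ContinuousLinearMap.adjoint_inner_left r, hra]
    simp [A, inner_smul_left, inner_smul_right]
    ring
  obtain ⟨S, hS, hSS⟩ := exists_clm_of_inner_eq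
    (fun p : Λ × 𝒢 => HTensor.tmul (kernelVec H p.1) (A p.1 p.2))
    (topologicalClosure_span_kernelVec_tmul H 𝒢) P (by
      rintro ⟨m, η⟩ ⟨l, ξ⟩
      rw [HTensor.inner_tmul]
      by_cases hm : d m = 0
      · simp [hβ.kernelVec_eq_zero hH hm, HTensor.zero_tmul]
      by_cases hl : d l = 0
      · simp [hβ.kernelVec_eq_zero hH hl, HTensor.zero_tmul]
      have hl' : star (d l) ≠ 0 := star_ne_zero.2 hl
      -- The factors `δ(m)`, `conj(δ(l))` and `1 - ⟪β(m), β(l)⟫` cancel against `K(m, l)`, leaving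
      -- the matrix entry of `P`.
      rw [hA, hQin, hH.inner_kernelVec, hβ.eq_kernel, ← hd]
      have := hβ.one_sub_inner_ne_zero m l
      field_simp)
  have hG : IsMultiplierAdjoint H (fun l => (A l).adjoint) S := fun l ξ => by
    rw [ContinuousLinearMap.adjoint_adjoint]; exact hS (l, ξ)
  -- `H ⊗ 𝒢` serves as `𝒢'` because it is the space on which the square root of `Q` acts.
  refine ⟨HTensor H 𝒢, inferInstance, inferInstance, inferInstance, fun l => (A l).adjoint,
    ⟨S, hG, norm_le_one_of_adjoint_comp_self hSS⟩, ?_⟩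
  rw [mulOp_eq hG]
  refine ⟨?_, range_adjoint_of_adjoint_comp_self hSS,
    fun x hx => rangeNorm_adjoint_of_adjoint_comp_self hSS hx⟩
  rw [ContinuousLinearMap.adjoint_adjoint, hSS]
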